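/- Let $p$ be a prime and let $G$ be a compact Lie group. Definitions. A topological group is $p$-toral if it is an extension of a torus $(S^1)^r$ (a normal subgroup) by a finite $p$-group (the quotient). A group is discrete $p$-toral if it is an extension of a group isomorphic to $(\mathbb{Z}/p^\infty)^r$ (a normal subgroup) by a finite $p$-group (the quotient). A discrete $p$-toral subgroup $P\subseteq G$ is snugly embedded if it is maximal among the discrete $p$-toral subgroups of its closure $\overline{P}$ in $G$. A $p$-discretization of a $p$-toral subgroup $\mathbf{P}\subseteq G$ is a snugly embedded discrete $p$-toral subgroup $P$ of $G$ with $\overline{P}=\mathbf{P}$. For a chain $P_0\subseteq\dots\subseteq P_k$ of subgroups of a group $H$, let $N_H(P_0\subseteq\dots\subseteq P_k)=\bigcap_i N_H(P_i)$, let $N_{P_k}(P_0\subseteq\dots\subseteq P_k)=P_k\cap N_H(P_0\subseteq\dots\subseteq P_k)$, and define $$\mathrm{Out}_H(P_0\subseteq\dots\subseteq P_k)=\frac{N_H(P_0\subseteq\dots\subseteq P_k)}{C_H(P_k)\cdot N_{P_k}(P_0\subseteq\dots\subseteq P_k)}.$$ Proposition. Let $k\ge 0$, let $\mathbf{P}_0\subseteq\dots\subseteq\mathbf{P}_k$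 be a chain of $p$-toral subgroups of $G$, and let $P_0\subseteq\dots\subseteq P_k$ be a chain of subgroups of $G$ such that $P_i$ is a $p$-discretization of $\mathbf{P}_i$ for every $i$. Then $N_G(P_0\subseteq\dots\subseteq P_k)\subseteq N_G(\mathbf{P}_0\subseteq\dots\subseteq\mathbf{P}_k)$, and this inclusion of normalizers induces a well-defined map on quotients which is a group isomorphism $$\mathrm{Out}_G(P_0\subseteq\dots\subseteq P_k)\xrightarrow{\ \cong\ }\mathrm{Out}_G(\mathbf{P}_0\subseteq\dots\subseteq\mathbf{P}_k).$$ -/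

import Mathlib

open scoped ContDiff Manifold

/-- The group `ℤ/p^∞`, realized as the group of complex numbers whose multiplicative order is a
power of `p`. -/
abbrev ZModPInfty (p : ℕ) [Fact p.Prime] : Type :=
  CommGroup.primaryComponent Circle p

/-- A topological group is `p`-toral if it is an extension of a torus `(S¹)^r` (a normal subgroup,
with the subspace topology) by a finite `p`-group (the quotient). -/
def IsPToral (p : ℕ) (P : Type*) [Group P] [TopologicalSpace P] : Prop :=
  ∃ (T : Subgroup P) (_ : T.Normal),
    (∃ r : ℕ, Nonempty (T ≃ₜ* (Fin r → Circle))) ∧ Finite (P ⧸ T) ∧ IsPGroup p (P ⧸ T)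

/-- A (discrete) group is discrete `p`-toral if it is an extension of a discrete `p`-torus
`(ℤ/p^∞)^r` (a normal subgroup) by a finite `p`-group (the quotient). -/
def IsDiscretePToral (p : ℕ) [Fact p.Prime] (P : Type*) [Group P] : Prop :=
  ∃ (T : Subgroup P) (_ : T.Normal),
    (∃ r : ℕ, Nonempty (T ≃* (Fin r → ZModPInfty p))) ∧ Finite (P ⧸ T) ∧ IsPGroup p (P ⧸ T)

/-- A discrete `p`-toral subgroup `P` is snugly embedded if it is maximal among the discrete
`p`-toral subgroups contained in its closure. -/
def IsSnug (p : ℕ) [Fact p.Prime] {G : Type*} [Group G] [TopologicalSpace G]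
    (P : Subgroup G) : Prop :=
  IsDiscretePToral p P ∧
    ∀ Q : Subgroup G, IsDiscretePToral p Q → P ≤ Q → (Q : Set G) ⊆ closure (P : Set G) → Q = P

/-- `P` is a `p`-discretization of the subgroup `PP`: it is a snugly embedded discrete `p`-toral
subgroup whose closure is `PP`. -/
def IsPDiscretization (p : ℕ) [Fact p.Prime] {G : Type*} [Group G] [TopologicalSpace G]
    (P PP : Subgroup G) : Prop :=
  IsSnug p P ∧ closure (P : Set G) = (PP : Set G)

namespace SubgroupChain

variable {H : Type*} [Group H] {k : ℕ}

/-- `N_H(P₀ ⊆ ⋯ ⊆ P_k)`: the elements of `H` that normalize every group of the chain. -/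
def normalizer (P : Fin (k + 1) →o Subgroup H) : Subgroup H :=
  ⨅ i, Subgroup.normalizer (P i : Set H)

/-- The top group `P_k` of the chain. -/
def top (P : Fin (k + 1) →o Subgroup H) : Subgroup H :=
  P (Fin.last k)

/-- `N_{P_k}(P₀ ⊆ ⋯ ⊆ P_k)`, as a subgroup of `H`. -/
def topNormalizer (P : Fin (k + 1) →o Subgroup H) : Subgroup H :=
  top P ⊓ normalizer P

/-- The subgroup `C_H(P_k) · N_{P_k}(P₀ ⊆ ⋯ ⊆ P_k)` of `H`; see `coe_inner` for the description of
the join as a set of products. -/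
def inner (P : Fin (k + 1) →o Subgroup H) : Subgroup H :=
  Subgroup.centralizer (top P : Set H) ⊔ topNormalizer P

theorem le_top (P : Fin (k + 1) →o Subgroup H) (i : Fin (k + 1)) : P i ≤ top P :=
  P.monotone (Fin.le_last i)

theorem centralizer_le_normalizer (P : Fin (k + 1) →o Subgroup H) :
    Subgroup.centralizer (top P : Set H) ≤ normalizer P := by
  refine le_iInf fun i => le_trans (Subgroup.centralizer_le (le_top P i)) ?_
  exact Subgroup.centralizer_le_normalizer _

theorem inner_le_normalizer (P : Fin (k + 1) →o Subgroup H) : inner P ≤ normalizer P :=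
  sup_le (centralizer_le_normalizer P) inf_le_right

theorem normalizer_le_normalizer_centralizer (P : Fin (k + 1) →o Subgroup H) :
    normalizer P ≤ Subgroup.normalizer (Subgroup.centralizer (top P : Set H) : Set H) := by
  rw [Subgroup.le_normalizer_iff]
  intro g hg c hc
  have hg' : g ∈ Subgroup.normalizer (top P : Set H) := (Subgroup.mem_iInf.mp hg) (Fin.last k)
  rw [Subgroup.mem_centralizer_iff] at hc ⊢
  intro x hx
  have h := hc _ ((Subgroup.mem_normalizer_iff''.mp hg' x).mp hx)
  calc x * (g * c * g⁻¹) = g * ((g⁻¹ * x * g) * c) * g⁻¹ := by group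
    _ = g * (c * (g⁻¹ * x * g)) * g⁻¹ := by rw [h]
    _ = g * c * g⁻¹ * x := by group

theorem normalizer_le_normalizer_topNormalizer (P : Fin (k + 1) →o Subgroup H) :
    normalizer P ≤ Subgroup.normalizer (topNormalizer P : Set H) := by
  rw [Subgroup.le_normalizer_iff]
  intro g hg x hx
  have hg' : g ∈ Subgroup.normalizer (top P : Set H) := (Subgroup.mem_iInf.mp hg) (Fin.last k)
  exact ⟨(Subgroup.mem_normalizer_iff.mp hg' x).mp hx.1,
    (normalizer P).mul_mem ((normalizer P).mul_mem hg hx.2) ((normalizer P).inv_mem hg)⟩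

theorem coe_inner (P : Fin (k + 1) →o Subgroup H) :
    (inner P : Set H) =
      {g | ∃ c ∈ Subgroup.centralizer (top P : Set H), ∃ x ∈ topNormalizer P, c * x = g} := by
  have h := Subgroup.coe_mul_of_right_le_normalizer_left
    (Subgroup.centralizer (top P : Set H)) (topNormalizer P)
    (inf_le_right.trans (normalizer_le_normalizer_centralizer P))
  rw [inner, h]
  ext g
  simp only [Set.mem_mul, SetLike.mem_coe, Set.mem_setOf_eq]

instance inner_normal (P : Fin (k + 1) →o Subgroup H) :
    ((inner P).subgroupOf (normalizer P)).Normal := by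
  rw [Subgroup.normal_subgroupOf_iff_le_normalizer (inner_le_normalizer P),
    Subgroup.le_normalizer_iff]
  intro g hg x hx
  obtain ⟨c, hc, y, hy, rfl⟩ := (coe_inner P).subset hx
  have h1 := Subgroup.le_normalizer_iff.mp (normalizer_le_normalizer_centralizer P) g hg c hc
  have h2 := Subgroup.le_normalizer_iff.mp (normalizer_le_normalizer_topNormalizer P) g hg y hy
  have h : g * (c * y) * g⁻¹ = (g * c * g⁻¹) * (g * y * g⁻¹) := by group
  rw [h]
  exact mul_mem (Subgroup.mem_sup_left h1) (Subgroup.mem_sup_right h2)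

/-- `Out_H(P₀ ⊆ ⋯ ⊆ P_k) = N_H(P₀ ⊆ ⋯ ⊆ P_k) / (C_H(P_k) · N_{P_k}(P₀ ⊆ ⋯ ⊆ P_k))`. -/
abbrev Out (P : Fin (k + 1) →o Subgroup H) : Type _ :=
  normalizer P ⧸ (inner P).subgroupOf (normalizer P)

end SubgroupChain

/-!
Only the topological group structure of `G` matters: the proof is a comparison inside each `p`-toral
group `PP i` of its torus `T`, its finite quotient `PP i ⧸ T`, and its discretizations.

Snugness forces a discretization `P` of `PP` to contain the `p`-power torsion `S` of `T`, since the
join of `P` and `S` is again discrete `p`-toral; as `P` is a `p`-group, it meets `T` in exactly `S`.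
As `T` is open and `P` is dense, `P` surjects onto `PP ⧸ T`. This is `IsPToral.exists_torus`.
Everything else rests on `T ⧸ S` being uniquely `p`-divisible, so that averaging over a finite
`p`-group is possible. Averaging a cocycle (`exists_cobounding_mod`) shows that two discretizations
of `PP` are conjugate by an element of `T`. Averaging a root of an element
(`exists_invariant_mod`) shows that elements of `T` which are invariant modulo `S` can be made
invariant by a factor in `S`. Two facts follow.

* `IsPDiscretization.exists_conj_smul_eq`: two discretizations of `PP` containing a common subgroup
  `R` are conjugate by an element of `PP` that centralizes `R`.
* `IsPDiscretization.exists_eq_mul`: an element of `PP` normalizing `P` is the product of an element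
  centralizing `P` and an element of `P`.

Applied successively to the members of a chain, with `R` the preceding member, the first one shows
that any two chains of discretizations of the same chain are conjugate by an element of its top
group (`exists_conj_smul_chain_eq`). An element normalizing the chain of `p`-toral subgroups carries
the given discretizations to others, so it can be corrected within the top group to normalize them;
this is surjectivity. The second fact gives injectivity, because `P` and its closure have the same
centralizer.
-/

/-! ### Averaging over a finite group -/

section Averaging

variable {π A : Type*} [Group π] [Finite π] [CommGroup A] (ρ : π →* MulAut A) (S : Subgroup A)

/-- A map `u : π → A` that is a `1`-cocycle modulo `S` is a coboundary modulo `S`, when every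
element of `A` has a `|π|`-th root and `A ⧸ S` has no `|π|`-torsion. The cobounding element is the
product of the `|π|`-th roots of the values of `u`. -/
theorem exists_cobounding_mod
    (hdiv : ∀ a : A, ∃ b : A, b ^ Nat.card π = a) (hS : ∀ a : A, a ^ Nat.card π ∈ S → a ∈ S)
    (u : π → A) (hu : ∀ b s, u b * ρ b (u s) * (u (b * s))⁻¹ ∈ S) :
    ∃ t : A, ∀ b, t * (ρ b t)⁻¹ * (u b)⁻¹ ∈ S := by
  have := Fintype.ofFinite π
  choose v hv using fun s => hdiv (u s)
  have hv' : ∀ b s, v b * ρ b (v s) * (v (b * s))⁻¹ ∈ S := by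
    intro b s
    apply hS
    rw [mul_pow, mul_pow, inv_pow, ← map_pow, hv, hv, hv]
    exact hu b s
  refine ⟨∏ s, v s, fun b => ?_⟩
  have hprod : ∏ s, v (b * s) = ∏ s, v s :=
    Fintype.prod_equiv (Equiv.mulLeft b) _ _ fun _ => rfl
  have hcard : ∏ _s : π, v b = u b := by
    rw [Finset.prod_const, Finset.card_univ, ← Nat.card_eq_fintype_card, hv]
  have hmem : ∏ s, (v b * ρ b (v s) * (v (b * s))⁻¹) ∈ S := prod_mem fun s _ => hv' b s
  rw [Finset.prod_mul_distrib, Finset.prod_mul_distrib, Finset.prod_inv_distrib, hprod, hcard,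
    ← map_prod] at hmem
  convert inv_mem hmem using 1
  rw [mul_inv_rev, mul_inv_rev, inv_inv, mul_assoc]

/-- An element of `A` that is invariant under `π` modulo `S` is congruent modulo `S` to an
invariant element, when it has a `|π|`-th root and `A ⧸ S` has no `|π|`-torsion: the norm of the
root is such an element. -/
theorem exists_invariant_mod
    (hdiv : ∀ a : A, ∃ b : A, b ^ Nat.card π = a) (hS : ∀ a : A, a ^ Nat.card π ∈ S → a ∈ S)
    (t : A) (ht : ∀ b, t * (ρ b t)⁻¹ ∈ S) :
    ∃ c : A, (∀ b, ρ b c = c) ∧ c⁻¹ * t ∈ S := by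
  have := Fintype.ofFinite π
  obtain ⟨w, rfl⟩ := hdiv t
  have hw : ∀ b, w * (ρ b w)⁻¹ ∈ S := by
    intro b
    apply hS
    rw [mul_pow, inv_pow, ← map_pow]
    exact ht b
  refine ⟨∏ s, ρ s w, fun b => ?_, ?_⟩
  · rw [map_prod]
    exact Fintype.prod_equiv (Equiv.mulLeft b) _ _ fun s => by simp
  · have hmem : ∏ s, (w * (ρ s w)⁻¹) ∈ S := prod_mem fun s _ => hw s
    rwa [Finset.prod_mul_distrib, Finset.prod_inv_distrib, Finset.prod_const, Finset.card_univ,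
      ← Nat.card_eq_fintype_card, mul_comm] at hmem

end Averaging

/-! ### Extensions of a divisible abelian group by a finite `p`-group -/

section Extension

open scoped Pointwise IsMulCommutative

/-- The action by conjugation of the quotient by an abelian normal subgroup on that subgroup. -/
def quotientConj {Γ : Type*} [Group Γ] (T : Subgroup Γ) [T.Normal] [IsMulCommutative T] :
    Γ ⧸ T →* MulAut T :=
  QuotientGroup.lift T MulAut.conjNormal fun t ht => by
    ext x
    have h : t * x = x * t := congrArg Subtype.val (mul_comm (⟨t, ht⟩ : T) x)
    simp [h]

@[simp]
theorem coe_quotientConj_mk {Γ : Type*} [Group Γ] (T : Subgroup Γ) [T.Normal] [IsMulCommutative T]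
    (g : Γ) (t : T) : (quotientConj T (QuotientGroup.mk g) t : Γ) = g * t * g⁻¹ :=
  MulAut.conjNormal_apply g t

variable {p : ℕ} {Γ : Type*} [Group Γ] {T : Subgroup Γ} [T.Normal] [IsMulCommutative T]

theorem mem_primaryComponent_of_pow_card {π : Type*} [Group π] [Finite π] [Fact p.Prime]
    (hπ : IsPGroup p π) {A : Type*} [CommGroup A] (a : A)
    (ha : a ^ Nat.card π ∈ CommGroup.primaryComponent A p) :
    a ∈ CommGroup.primaryComponent A p := by
  obtain ⟨n, hn⟩ := IsPGroup.iff_card.mp hπ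
  obtain ⟨m, hm⟩ := ha
  exact ⟨n + m, by rwa [pow_add, pow_mul, ← hn]⟩

/-- If the commutators of `t ∈ T` with the elements of `R` are `p`-power torsion, then `t` agrees
up to `p`-power torsion with an element of `T` centralizing `R`. -/
theorem exists_mem_centralizer_of_commutator_torsion [Fact p.Prime] [Finite (Γ ⧸ T)]
    (hp : IsPGroup p (Γ ⧸ T)) (hdiv : ∀ n ≠ 0, ∀ t : T, ∃ v : T, v ^ n = t)
    (R : Subgroup Γ) (t : Γ) (ht : t ∈ T) (h : ∀ a ∈ R, ∃ n : ℕ, (t * a * t⁻¹ * a⁻¹) ^ p ^ n = 1) :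
    ∃ c ∈ T, c ∈ Subgroup.centralizer (R : Set Γ) ∧ ∃ n : ℕ, (c⁻¹ * t) ^ p ^ n = 1 := by
  -- only the image of `R` in the finite quotient acts on `T`
  let R' : Subgroup (Γ ⧸ T) := R.map (QuotientGroup.mk' T)
  obtain ⟨c, hc, n, hn⟩ := exists_invariant_mod ((quotientConj T).comp R'.subtype)
    (CommGroup.primaryComponent T p) (hdiv _ Nat.card_pos.ne')
    (mem_primaryComponent_of_pow_card (hp.to_subgroup R')) ⟨t, ht⟩ (by
      rintro ⟨-, a, ha, rfl⟩
      obtain ⟨n, hn⟩ := h a ha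
      refine ⟨n, Subtype.ext ?_⟩
      simpa [mul_assoc] using hn)
  refine ⟨c, c.2, ?_, n, by simpa using congrArg Subtype.val hn⟩
  intro a ha
  have := congrArg Subtype.val (hc ⟨QuotientGroup.mk' T a, Subgroup.mem_map_of_mem _ ha⟩)
  simp only [MonoidHom.comp_apply, Subgroup.subtype_apply, QuotientGroup.mk'_apply,
    coe_quotientConj_mk] at this
  exact mul_inv_eq_iff_eq_mul.mp this

/-- Two subgroups `P` and `Q` that surject onto `Γ ⧸ T` and meet `T` in its `p`-power torsion are
conjugate by an element of `T`. -/
theorem exists_conj_smul_eq [Fact p.Prime] [Finite (Γ ⧸ T)]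
    (hp : IsPGroup p (Γ ⧸ T)) (hdiv : ∀ n ≠ 0, ∀ t : T, ∃ v : T, v ^ n = t)
    {P Q : Subgroup Γ}
    (hPT : ∀ x : Γ, ∃ y ∈ P, x * y⁻¹ ∈ T) (hPS : ∀ x ∈ T, x ∈ P ↔ ∃ n : ℕ, x ^ p ^ n = 1)
    (hQT : ∀ x : Γ, ∃ y ∈ Q, x * y⁻¹ ∈ T) (hQS : ∀ x ∈ T, x ∈ Q ↔ ∃ n : ℕ, x ^ p ^ n = 1) :
    ∃ t ∈ T, MulAut.conj t • P = Q := by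
  have hPQ : ∀ x ∈ T, x ∈ P → x ∈ Q := fun x hx h => (hQS x hx).mpr ((hPS x hx).mp h)
  choose a ha haT using fun s : Γ ⧸ T => hPT s.out
  choose d hd hdT using fun s : Γ ⧸ T => hQT (a s)
  have hmk : ∀ s, (QuotientGroup.mk (a s) : Γ ⧸ T) = s := fun s => by
    rw [← QuotientGroup.eq_iff_div_mem.mpr (by simpa [div_eq_mul_inv] using haT s),
      QuotientGroup.out_eq']
  have hudiv : ∀ x y : Γ, (QuotientGroup.mk x : Γ ⧸ T) = QuotientGroup.mk y → x * y⁻¹ ∈ T :=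
    fun x y h => by simpa [div_eq_mul_inv] using QuotientGroup.eq_iff_div_mem.mp h
  have hu : ∀ s, d s * (a s)⁻¹ ∈ T := fun s => by simpa using inv_mem (hdT s)
  -- `P` and `Q` differ by a cocycle with values in `T` modulo torsion
  obtain ⟨t, ht⟩ := exists_cobounding_mod (quotientConj T) (CommGroup.primaryComponent T p)
    (hdiv _ Nat.card_pos.ne') (mem_primaryComponent_of_pow_card hp)
    (fun s => ⟨d s * (a s)⁻¹, hu s⟩) (by
      intro b s
      have hmem : (a s)⁻¹ * (a b)⁻¹ * a (b * s) ∈ T := by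
        have : (QuotientGroup.mk (a b * a s) : Γ ⧸ T) = QuotientGroup.mk (a (b * s)) := by
          rw [QuotientGroup.mk_mul, hmk, hmk, hmk]
        simpa [mul_inv_rev] using QuotientGroup.eq.mp this
      have hQ : (a s)⁻¹ * (a b)⁻¹ * a (b * s) ∈ Q :=
        hPQ _ hmem (mul_mem (mul_mem (inv_mem (ha s)) (inv_mem (ha b))) (ha _))
      have hcoe : ((⟨d b * (a b)⁻¹, hu b⟩ * quotientConj T b ⟨d s * (a s)⁻¹, hu s⟩ *
          (⟨d (b * s) * (a (b * s))⁻¹, hu (b * s)⟩ : T)⁻¹ : T) : Γ) =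
          d b * d s * ((a s)⁻¹ * (a b)⁻¹ * a (b * s)) * (d (b * s))⁻¹ := by
        have := coe_quotientConj_mk T (a b) ⟨d s * (a s)⁻¹, hu s⟩
        rw [hmk] at this
        simp only [Subgroup.coe_mul, Subgroup.coe_inv, this]
        group
      obtain ⟨n, hn⟩ := (hQS _ (hcoe ▸ Subtype.prop _)).mp
        (mul_mem (mul_mem (mul_mem (hd b) (hd s)) hQ) (inv_mem (hd (b * s))))
      exact ⟨n, Subtype.ext (by rw [Subgroup.coe_pow, hcoe, hn, Subgroup.coe_one])⟩)
  have key : ∀ b, (t : Γ) * a b * (t : Γ)⁻¹ ∈ Q := by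
    intro b
    obtain ⟨n, hn⟩ := ht b
    have hcoe : ((t * (quotientConj T b t)⁻¹ * (⟨d b * (a b)⁻¹, hu b⟩ : T)⁻¹ : T) : Γ) =
        t * a b * (t : Γ)⁻¹ * (d b)⁻¹ := by
      have := coe_quotientConj_mk T (a b) t
      rw [hmk] at this
      simp only [Subgroup.coe_mul, Subgroup.coe_inv, this]
      group
    have hQ := (hQS _ (hcoe ▸ Subtype.prop _)).mpr ⟨n, by
      rw [← hcoe, ← Subgroup.coe_pow, hn, Subgroup.coe_one]⟩
    simpa using mul_mem hQ (hd b)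
  have hcomm : ∀ x ∈ T, (t : Γ) * x = x * t := fun x hx =>
    congrArg Subtype.val (mul_comm t ⟨x, hx⟩)
  refine ⟨t, t.2, le_antisymm ?_ fun x hx => ?_⟩
  · rintro - ⟨x, hx, rfl⟩
    change (t : Γ) * x * (t : Γ)⁻¹ ∈ Q
    have hT : x * (a (QuotientGroup.mk x))⁻¹ ∈ T := hudiv _ _ (hmk _).symm
    have hQ := mul_mem (hPQ _ hT (mul_mem hx (inv_mem (ha _)))) (key (QuotientGroup.mk x))
    rw [← mul_assoc, ← mul_assoc, ← hcomm _ hT] at hQ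
    simpa [mul_assoc] using hQ
  · have hT : x * ((t : Γ) * a (QuotientGroup.mk x) * (t : Γ)⁻¹)⁻¹ ∈ T := by
      apply hudiv
      simp [hmk, (QuotientGroup.eq_one_iff (t : Γ)).mpr t.2]
    have hP := mul_mem ((hPS _ hT).mpr ((hQS _ hT).mp
      (mul_mem hx (inv_mem (key (QuotientGroup.mk x)))))) (ha (QuotientGroup.mk x))
    refine ⟨_, hP, ?_⟩
    change (t : Γ) * _ * (t : Γ)⁻¹ = x
    rw [← mul_assoc, hcomm _ hT]
    group

end Extension

/-! ### Discrete `p`-toral groups -/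

section DiscretePToral

variable {p : ℕ} [Fact p.Prime]

theorem exists_pow_eq_one_of_pi {r : ℕ} (z : Fin r → ZModPInfty p) : ∃ n : ℕ, z ^ p ^ n = 1 := by
  choose m hm using fun i => CommGroup.mem_primaryComponent.mp (z i).2
  refine ⟨∑ i, m i, funext fun i => Subtype.ext ?_⟩
  obtain ⟨c, hc⟩ := pow_dvd_pow p (Finset.single_le_sum (f := m) (fun _ _ => Nat.zero_le _)
    (Finset.mem_univ i))
  simp only [Pi.pow_apply, Subgroup.coe_pow, hc, pow_mul, hm, one_pow, Pi.one_apply,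
    Subgroup.coe_one]

theorem IsDiscretePToral.isPGroup {P : Type*} [Group P] (h : IsDiscretePToral p P) :
    IsPGroup p P := by
  obtain ⟨T, hT, ⟨r, ⟨e⟩⟩, -, hq⟩ := h
  rw [isPGroup_iff_pow_pow_eq_one] at hq ⊢
  intro g
  obtain ⟨n, hn⟩ := hq (QuotientGroup.mk g)
  have hg : g ^ p ^ n ∈ T := (QuotientGroup.eq_one_iff _).mp hn
  obtain ⟨m, h1⟩ := exists_pow_eq_one_of_pi (e ⟨_, hg⟩)
  refine ⟨n + m, ?_⟩
  rw [← map_pow, map_eq_one_iff e e.injective] at h1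
  rw [pow_add, pow_mul]
  exact congrArg Subtype.val h1

theorem IsDiscretePToral.of_mulEquiv {P Q : Type*} [Group P] [Group Q] (h : IsDiscretePToral p P)
    (e : P ≃* Q) : IsDiscretePToral p Q := by
  obtain ⟨T, hT, ⟨r, ⟨f⟩⟩, hfin, hq⟩ := h
  have hN : (T.map (e : P →* Q)).Normal := hT.map _ e.surjective
  let e' : P ⧸ T ≃* Q ⧸ T.map (e : P →* Q) := QuotientGroup.congr T _ e rfl
  exact ⟨T.map (e : P →* Q), hN, ⟨r, ⟨(e.subgroupMap T).symm.trans f⟩⟩,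
    Finite.of_equiv _ e'.toEquiv, hq.of_equiv e'⟩

theorem exists_pow_eq_of_mulEquiv_circle {T : Type*} [Group T] {r : ℕ} (e : T ≃* (Fin r → Circle))
    {n : ℕ} (hn : n ≠ 0) (t : T) : ∃ v : T, v ^ n = t := by
  choose θ hθ using fun i => Circle.exp_surjective (e t i)
  refine ⟨e.symm fun i => Circle.exp (θ i / n), ?_⟩
  rw [← map_pow, MulEquiv.symm_apply_eq]
  funext i
  rw [Pi.pow_apply, ← Circle.exp_nsmul, ← hθ, nsmul_eq_mul, mul_div_cancel₀]
  exact_mod_cast hn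

/-- The `p`-power torsion of a torus `(S¹)^r` is a discrete `p`-torus `(ℤ/p^∞)^r`. -/
theorem exists_subgroup_of_mulEquiv_circle {Γ : Type*} [Group Γ] (T : Subgroup Γ) {r : ℕ}
    (e : T ≃* (Fin r → Circle)) :
    ∃ S : Subgroup Γ, Nonempty (S ≃* (Fin r → ZModPInfty p)) ∧
      ∀ x, x ∈ S ↔ x ∈ T ∧ ∃ n : ℕ, x ^ p ^ n = 1 := by
  let j : (Fin r → ZModPInfty p) →* Γ := T.subtype.comp
    ((e.symm : (Fin r → Circle) →* T).comp
      (MonoidHom.compLeft (CommGroup.primaryComponent Circle p).subtype (Fin r)))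
  have hj : Function.Injective j :=
    T.subtype_injective.comp (e.symm.injective.comp
      (Function.Injective.comp_left (Subgroup.subtype_injective _)))
  refine ⟨j.range, ⟨(MonoidHom.ofInjective hj).symm⟩, fun x => ⟨?_, ?_⟩⟩
  · rintro ⟨z, rfl⟩
    refine ⟨Subtype.prop _, ?_⟩
    obtain ⟨m, hm⟩ := exists_pow_eq_one_of_pi z
    exact ⟨m, by rw [← map_pow, hm, map_one]⟩
  · rintro ⟨hx, n, hn⟩
    have h1 : e ⟨x, hx⟩ ^ p ^ n = 1 := by
      rw [← map_pow, map_eq_one_iff e e.injective]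
      exact Subtype.ext hn
    refine ⟨fun i => ⟨e ⟨x, hx⟩ i, n, congrFun h1 i⟩, ?_⟩
    change ((e.symm (e ⟨x, hx⟩) : T) : Γ) = x
    rw [e.symm_apply_apply]

/-- In an extension of a torus `T` by a finite group, the join of a `p`-group with the
`p`-power torsion of `T` is discrete `p`-toral. -/
theorem exists_isDiscretePToral_sup {Γ : Type*} [Group Γ] (T : Subgroup Γ) [T.Normal]
    [Finite (Γ ⧸ T)] {r : ℕ} (e : T ≃* (Fin r → Circle)) (P : Subgroup Γ) (hP : IsPGroup p P) :
    ∃ Q : Subgroup Γ, P ≤ Q ∧ IsDiscretePToral p Q ∧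
      ∀ x ∈ T, (∃ n : ℕ, x ^ p ^ n = 1) → x ∈ Q := by
  obtain ⟨S, ⟨f⟩, hS⟩ := exists_subgroup_of_mulEquiv_circle (p := p) T e
  have hN : S.Normal := ⟨fun x hx g => by
    obtain ⟨hxT, n, hn⟩ := (hS x).mp hx
    exact (hS _).mpr ⟨Subgroup.Normal.conj_mem inferInstance x hxT g, n, by simp [conj_pow, hn]⟩⟩
  have hSp : IsPGroup p S := isPGroup_iff_pow_pow_eq_one.mpr fun x => by
    obtain ⟨-, n, hn⟩ := (hS x).mp x.2
    exact ⟨n, Subtype.ext hn⟩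
  have hQ : IsPGroup p (P ⊔ S : Subgroup Γ) := hP.to_sup_of_normal_right hSp
  refine ⟨P ⊔ S, le_sup_left, ⟨S.subgroupOf (P ⊔ S), inferInstance,
    ⟨r, ⟨(Subgroup.subgroupOfEquivOfLe le_sup_right).trans f⟩⟩, ?_, hQ.to_quotient _⟩,
    fun x hx h => Subgroup.mem_sup_right ((hS x).mpr ⟨hx, h⟩)⟩
  -- since `P ⊔ S` is a `p`-group, it meets `T` in `S`, and so its quotient by `S` is finite
  have hST : S.subgroupOf (P ⊔ S) = T.subgroupOf (P ⊔ S) := by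
    ext x
    rw [Subgroup.mem_subgroupOf, Subgroup.mem_subgroupOf, hS]
    refine and_iff_left ?_
    obtain ⟨n, hn⟩ := isPGroup_iff_pow_pow_eq_one.mp hQ x
    exact ⟨n, congrArg Subtype.val hn⟩
  have : T.FiniteIndex := Subgroup.finiteIndex_of_finite_quotient
  rw [hST]
  infer_instance

end DiscretePToral

/-! ### Conjugation of subgroups -/

section Conjugation

open scoped Pointwise

variable {G : Type*} [Group G]

theorem mem_normalizer_iff_conj_smul_eq {H : Subgroup G} {g : G} :
    g ∈ Subgroup.normalizer (H : Set G) ↔ MulAut.conj g • H = H :=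
  Subgroup.mem_normalizer_iff_map_conj_eq

theorem conj_smul_eq_self_of_mem_centralizer {H R : Subgroup G} {c : G}
    (hc : c ∈ Subgroup.centralizer (R : Set G)) (hHR : H ≤ R) : MulAut.conj c • H = H :=
  mem_normalizer_iff_conj_smul_eq.mp
    (Subgroup.centralizer_le_normalizer _ (Subgroup.centralizer_le hHR hc))

theorem mem_chain_normalizer_iff {k : ℕ} {P : Fin (k + 1) →o Subgroup G} {g : G} :
    g ∈ SubgroupChain.normalizer P ↔ ∀ i, MulAut.conj g • P i = P i := by
  simp only [SubgroupChain.normalizer, Subgroup.mem_iInf, mem_normalizer_iff_conj_smul_eq]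

end Conjugation

/-! ### Discretizations of a `p`-toral subgroup -/

section Discretization

open scoped Pointwise

variable {p : ℕ} [Fact p.Prime] {G : Type*} [Group G] [TopologicalSpace G]

theorem IsPDiscretization.le {P PP : Subgroup G} (h : IsPDiscretization p P PP) : P ≤ PP :=
  fun _ hx => h.2.subset (subset_closure hx)

/-- A discretization of a `p`-toral group contains the `p`-power torsion of its torus. -/
theorem IsPDiscretization.mem_of_pow_eq_one {P PP : Subgroup G} (h : IsPDiscretization p P PP)
    (T : Subgroup PP) [T.Normal] [Finite (PP ⧸ T)] {r : ℕ} (e : T ≃* (Fin r → Circle))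
    {x : PP} (hx : x ∈ T) {n : ℕ} (hn : x ^ p ^ n = 1) : (x : G) ∈ P := by
  have hP : IsPGroup p (P.subgroupOf PP) :=
    h.1.1.isPGroup.of_equiv (Subgroup.subgroupOfEquivOfLe h.le).symm
  obtain ⟨Q, hPQ, hQ, hTQ⟩ := exists_isDiscretePToral_sup T e _ hP
  have hmap : Q.map PP.subtype = P := by
    refine h.1.2 _ (hQ.of_mulEquiv (Q.equivMapOfInjective _ PP.subtype_injective)) ?_ ?_
    · exact fun y hy => ⟨⟨y, h.le hy⟩, hPQ hy, rfl⟩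
    · rw [h.2]
      rintro - ⟨y, -, rfl⟩
      exact y.2
  rw [← hmap]
  exact ⟨x, hTQ x hx ⟨n, hn⟩, rfl⟩

/-- A discretization of a `p`-toral group surjects onto the quotient by the torus, because the
torus is open and the discretization is dense. -/
theorem IsPDiscretization.exists_mul_inv_mem [IsTopologicalGroup G] {P PP : Subgroup G}
    (h : IsPDiscretization p P PP) (T : Subgroup PP) (hT : IsOpen (T : Set PP)) (x : PP) :
    ∃ y ∈ P.subgroupOf PP, x * y⁻¹ ∈ T := by
  have hU : IsOpen {y : PP | x * y⁻¹ ∈ T} := hT.preimage (by fun_prop)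
  obtain ⟨V, hV, hVU⟩ := isOpen_induced_iff.mp hU
  have hxV : (x : G) ∈ V := by
    have : x ∈ ((↑) : PP → G) ⁻¹' V := by rw [hVU]; simp
    exact this
  obtain ⟨y, hyV, hyP⟩ := mem_closure_iff.mp (h.2.superset x.2) V hV hxV
  exact ⟨⟨y, h.le hyP⟩, hyP, hVU.subset (show (⟨y, h.le hyP⟩ : PP) ∈ _ from hyV)⟩

/-- The structure of a `p`-toral subgroup `PP` used below: an abelian normal subgroup `T` which is
divisible and has a finite `p`-group as quotient, and such that each discretization of `PP`
surjects onto `PP ⧸ T` and meets `T` in its `p`-power torsion. -/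
theorem IsPToral.exists_torus [IsTopologicalGroup G] [T2Space G] {PP : Subgroup G}
    (hPP : IsPToral p PP) :
    ∃ (T : Subgroup PP) (_ : T.Normal), IsMulCommutative T ∧ Finite (PP ⧸ T) ∧
      IsPGroup p (PP ⧸ T) ∧ (∀ n ≠ 0, ∀ t : T, ∃ v : T, v ^ n = t) ∧
      ∀ P : Subgroup G, IsPDiscretization p P PP →
        (∀ x : PP, ∃ y ∈ P.subgroupOf PP, x * y⁻¹ ∈ T) ∧
        ∀ x ∈ T, x ∈ P.subgroupOf PP ↔ ∃ n : ℕ, x ^ p ^ n = 1 := by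
  obtain ⟨T, hN, ⟨r, ⟨e⟩⟩, hfin, hq⟩ := hPP
  have hcpt : CompactSpace T := e.symm.toHomeomorph.compactSpace
  have : T.FiniteIndex := Subgroup.finiteIndex_of_finite_quotient
  have hopen : IsOpen (T : Set PP) := T.isOpen_of_isClosed_of_finiteIndex
    (isCompact_iff_compactSpace.mpr hcpt).isClosed
  refine ⟨T, hN, .of_comm fun a b => e.injective (by rw [map_mul, map_mul, mul_comm]), hfin, hq,
    fun n hn t => exists_pow_eq_of_mulEquiv_circle e.toMulEquiv hn t, fun P hP =>
    ⟨hP.exists_mul_inv_mem T hopen, fun x hx => ⟨fun hxP => ?_, fun ⟨n, hn⟩ =>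
      hP.mem_of_pow_eq_one T e.toMulEquiv hx hn⟩⟩⟩
  obtain ⟨n, hn⟩ := isPGroup_iff_pow_pow_eq_one.mp hP.1.1.isPGroup ⟨x, hxP⟩
  exact ⟨n, Subtype.ext (congrArg (Subtype.val : P → G) hn)⟩

/-- Conjugates of a discretization are discretizations of the conjugate subgroup. -/
theorem IsPDiscretization.conj_smul [IsTopologicalGroup G] {P PP : Subgroup G}
    (h : IsPDiscretization p P PP) (g : G) :
    IsPDiscretization p (MulAut.conj g • P) (MulAut.conj g • PP) := by
  let c : G ≃ₜ G := (Homeomorph.mulLeft g).trans (Homeomorph.mulRight g⁻¹)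
  have hc : ∀ H : Subgroup G, ((MulAut.conj g • H : Subgroup G) : Set G) = c '' H := fun _ => rfl
  have hcl : closure ((MulAut.conj g • P : Subgroup G) : Set G) =
      ((MulAut.conj g • PP : Subgroup G) : Set G) := by
    rw [hc, hc, ← h.2, c.image_closure]
  refine ⟨⟨h.1.1.of_mulEquiv (Subgroup.equivSMul (MulAut.conj g) P), fun Q hQ hPQ hQc => ?_⟩, hcl⟩
  rw [← inv_smul_eq_iff]
  refine h.1.2 _ (hQ.of_mulEquiv (Subgroup.equivSMul (MulAut.conj g)⁻¹ Q))
    (Subgroup.subset_pointwise_smul_iff.mpr (by rwa [inv_inv])) ?_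
  rw [hcl] at hQc
  rw [h.2]
  exact Subgroup.pointwise_smul_subset_iff.mpr (by rwa [inv_inv])

/-- Two discretizations of a `p`-toral subgroup `PP` are conjugate by an element of `PP`, which can
be chosen to centralize any given common subgroup `R`. -/
theorem IsPDiscretization.exists_conj_smul_eq [IsTopologicalGroup G] [T2Space G]
    {P Q PP R : Subgroup G} (hPP : IsPToral p PP)
    (hP : IsPDiscretization p P PP) (hQ : IsPDiscretization p Q PP) (hRP : R ≤ P) (hRQ : R ≤ Q) :
    ∃ c ∈ PP, c ∈ Subgroup.centralizer (R : Set G) ∧ MulAut.conj c • P = Q := by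
  obtain ⟨T, hN, hcomm, hfin, hp, hdiv, hT⟩ := hPP.exists_torus
  obtain ⟨hPT, hPS⟩ := hT P hP
  obtain ⟨hQT, hQS⟩ := hT Q hQ
  obtain ⟨t, htT, htPQ⟩ := _root_.exists_conj_smul_eq hp hdiv hPT hPS hQT hQS
  rw [Subgroup.conj_smul_subgroupOf hP.le, Subgroup.subgroupOf_inj,
    inf_eq_left.mpr (Subgroup.conj_smul_le_of_le hP.le t), inf_eq_left.mpr hQ.le] at htPQ
  have hR : R ≤ PP := hRP.trans hP.le
  -- for `a ∈ R`, both `t * a * t⁻¹` and `a` lie in `Q`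
  obtain ⟨c, hcT, hcR, n, hn⟩ := exists_mem_centralizer_of_commutator_torsion hp hdiv
    (R.subgroupOf PP) t htT fun a ha => by
      refine (hQS _ ?_).mp ?_
      · rw [mul_assoc, mul_assoc]
        exact mul_mem htT (by simpa [mul_assoc] using hN.conj_mem _ (inv_mem htT) a)
      · refine mul_mem ?_ (inv_mem (hRQ ha))
        rw [Subgroup.mem_subgroupOf, ← htPQ]
        exact ⟨a, hRP ha, rfl⟩
  refine ⟨c, c.2, fun a ha => ?_, ?_⟩
  · exact congrArg Subtype.val (hcR ⟨a, hR ha⟩ ha)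
  · have hu : ((c⁻¹ * t : PP) : G) ∈ P := (hPS _ (mul_mem (inv_mem hcT) htT)).mpr ⟨n, hn⟩
    nth_rw 1 [← htPQ, ← Subgroup.conj_smul_eq_self_of_mem hu]
    rw [← mul_smul, ← map_mul]
    simp

/-- The normalizer of a discretization `P` in the `p`-toral group `PP` is contained in the product
of `P` with its centralizer. -/
theorem IsPDiscretization.exists_eq_mul [IsTopologicalGroup G] [T2Space G]
    {P PP : Subgroup G} (hPP : IsPToral p PP) (hP : IsPDiscretization p P PP) {x : G} (hx : x ∈ PP)
    (hxP : x ∈ Subgroup.normalizer (P : Set G)) :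
    ∃ c ∈ Subgroup.centralizer (P : Set G), ∃ y ∈ P, c * y = x := by
  obtain ⟨T, hN, hcomm, hfin, hp, hdiv, hT⟩ := hPP.exists_torus
  obtain ⟨hPT, hPS⟩ := hT P hP
  obtain ⟨y, hy, hyT⟩ := hPT ⟨x, hx⟩
  have hyP : x * (y : G)⁻¹ ∈ Subgroup.normalizer (P : Set G) :=
    mul_mem hxP (inv_mem (Subgroup.le_normalizer hy))
  obtain ⟨c, hcT, hcP, n, hn⟩ := exists_mem_centralizer_of_commutator_torsion hp hdiv
    (P.subgroupOf PP) _ hyT fun a ha => by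
      refine (hPS _ ?_).mp ?_
      · rw [mul_assoc, mul_assoc]
        exact mul_mem hyT (by simpa only [mul_assoc] using hN.conj_mem _ (inv_mem hyT) a)
      · exact mul_mem ((Subgroup.mem_normalizer_iff.mp hyP a).mp ha) (inv_mem ha)
  refine ⟨c, fun a ha => congrArg Subtype.val (hcP ⟨a, hP.le ha⟩ ha), _,
    mul_mem ((hPS _ (mul_mem (inv_mem hcT) hyT)).mpr ⟨n, hn⟩) hy, ?_⟩
  simp [mul_assoc]

theorem IsPDiscretization.normalizer_le [IsTopologicalGroup G] {P PP : Subgroup G}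
    (h : IsPDiscretization p P PP) :
    Subgroup.normalizer (P : Set G) ≤ Subgroup.normalizer (PP : Set G) := by
  intro g hg
  rw [mem_normalizer_iff_conj_smul_eq] at hg ⊢
  have h' := (h.conj_smul g).2
  rw [hg, h.2] at h'
  exact SetLike.coe_injective h'.symm

theorem IsPDiscretization.centralizer_eq [IsTopologicalGroup G] [T2Space G] {P PP : Subgroup G}
    (h : IsPDiscretization p P PP) :
    Subgroup.centralizer (P : Set G) = Subgroup.centralizer (PP : Set G) := by
  refine le_antisymm (fun c hc x hx => ?_) (Subgroup.centralizer_le h.le)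
  have hcl : IsClosed {y : G | y * c = c * y} := isClosed_eq (by fun_prop) (by fun_prop)
  exact closure_minimal (fun y hy => hc y hy) hcl (h.2.superset hx)

end Discretization

/-! ### Chains of discretizations -/

section Chain

open scoped Pointwise

variable {p : ℕ} [Fact p.Prime] {G : Type*} [Group G] [TopologicalSpace G]
  [IsTopologicalGroup G] {k : ℕ} {PP P Q : Fin (k + 1) →o Subgroup G}

/-- Two chains of discretizations of the same chain of `p`-toral subgroups are conjugate, by an
element of the largest of these. The conjugating element is built along the chain: once the groups
below `P (j + 1)` are matched with those of the other chain, `P (j + 1)` is moved to `Q (j + 1)` by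
an element centralizing `Q j`. -/
theorem exists_conj_smul_chain_eq [T2Space G] (hPP : ∀ i, IsPToral p (PP i))
    (hP : ∀ i, IsPDiscretization p (P i) (PP i)) (hQ : ∀ i, IsPDiscretization p (Q i) (PP i))
    (j : Fin (k + 1)) : ∃ x ∈ PP j, ∀ i ≤ j, MulAut.conj x • P i = Q i := by
  induction j using Fin.induction with
  | zero =>
    obtain ⟨c, hc, -, h⟩ := (hP 0).exists_conj_smul_eq (hPP 0) (hQ 0) bot_le bot_le
    refine ⟨c, hc, fun i hi => ?_⟩
    rwa [Fin.le_zero_iff.mp hi]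
  | succ j ih =>
    obtain ⟨x, hx, h⟩ := ih
    have hx' : x ∈ PP j.succ := PP.monotone (Fin.castSucc_le_succ j) hx
    have hP' := (hP j.succ).conj_smul x
    rw [Subgroup.conj_smul_eq_self_of_mem hx'] at hP'
    obtain ⟨c, hc, hcQ, hcPQ⟩ := hP'.exists_conj_smul_eq (hPP _) (hQ _) (R := Q j.castSucc)
      (by
        rw [← h _ le_rfl, Subgroup.pointwise_smul_le_pointwise_smul_iff]
        exact P.monotone (Fin.castSucc_le_succ j))
      (Q.monotone (Fin.castSucc_le_succ j))
    refine ⟨c * x, mul_mem hc hx', fun i hi => ?_⟩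
    rw [map_mul, mul_smul]
    rcases hi.eq_or_lt with rfl | hi
    · exact hcPQ
    · have hi' : i ≤ j.castSucc := Fin.le_castSucc_iff.mpr hi
      rw [h i hi', conj_smul_eq_self_of_mem_centralizer hcQ (Q.monotone hi')]

theorem chain_normalizer_le (hP : ∀ i, IsPDiscretization p (P i) (PP i)) :
    SubgroupChain.normalizer P ≤ SubgroupChain.normalizer PP :=
  iInf_mono fun i => (hP i).normalizer_le

theorem chain_inner_le [T2Space G] (hP : ∀ i, IsPDiscretization p (P i) (PP i)) :
    SubgroupChain.inner P ≤ SubgroupChain.inner PP :=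
  sup_le_sup (hP _).centralizer_eq.le (inf_le_inf (hP _).le (chain_normalizer_le hP))

/-- An element normalizing the discretizations is trivial in the outer automizer of the
discretized chain if it is trivial in that of the chain of `p`-toral subgroups. -/
theorem mem_chain_inner_of_mem [T2Space G] (hPP : ∀ i, IsPToral p (PP i))
    (hP : ∀ i, IsPDiscretization p (P i) (PP i)) {g : G} (hg : g ∈ SubgroupChain.normalizer P)
    (h : g ∈ SubgroupChain.inner PP) : g ∈ SubgroupChain.inner P := by
  obtain ⟨c, hc, x, hx, rfl⟩ := (SubgroupChain.coe_inner PP).subset h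
  have hcP : c ∈ Subgroup.centralizer (SubgroupChain.top P : Set G) := (hP _).centralizer_eq.ge hc
  have hxN : x ∈ SubgroupChain.normalizer P :=
    (Subgroup.mul_mem_cancel_left _ (SubgroupChain.centralizer_le_normalizer P hcP)).mp hg
  obtain ⟨d, hd, y, hy, rfl⟩ :=
    (hP _).exists_eq_mul (hPP _) hx.1 (Subgroup.mem_iInf.mp hxN (Fin.last k))
  have hyN : y ∈ SubgroupChain.normalizer P :=
    (Subgroup.mul_mem_cancel_left _ (SubgroupChain.centralizer_le_normalizer P hd)).mp hxN
  exact mul_mem (Subgroup.mem_sup_left hcP)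
    (mul_mem (Subgroup.mem_sup_left hd) (Subgroup.mem_sup_right ⟨hy, hyN⟩))

/-- Every element normalizing the chain of `p`-toral subgroups can be corrected, by an element of
the top group normalizing that chain, to one normalizing the discretizations. -/
theorem exists_mul_mem_chain_normalizer [T2Space G] (hPP : ∀ i, IsPToral p (PP i))
    (hP : ∀ i, IsPDiscretization p (P i) (PP i)) {g : G} (hg : g ∈ SubgroupChain.normalizer PP) :
    ∃ x ∈ SubgroupChain.topNormalizer PP, x * g ∈ SubgroupChain.normalizer P := by
  let Q : Fin (k + 1) →o Subgroup G :=
    ⟨fun i => MulAut.conj g • P i, fun _ _ h =>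
      Subgroup.pointwise_smul_le_pointwise_smul_iff.mpr (P.monotone h)⟩
  have hQ : ∀ i, IsPDiscretization p (Q i) (PP i) := fun i => by
    have h := (hP i).conj_smul g
    rwa [mem_chain_normalizer_iff.mp hg i] at h
  obtain ⟨x, hx, h⟩ := exists_conj_smul_chain_eq hPP hQ hP (Fin.last k)
  have hxg : x * g ∈ SubgroupChain.normalizer P := mem_chain_normalizer_iff.mpr fun i => by
    rw [map_mul, mul_smul]
    exact h i (Fin.le_last i)
  exact ⟨x, ⟨hx, (Subgroup.mul_mem_cancel_right _ hg).mp (chain_normalizer_le hP hxg)⟩, hxg⟩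

end Chain

/-! ### Outer automizers of chains -/

theorem mainTheorem3 (p : ℕ) [Fact p.Prime]
    {E : Type*} [NormedAddCommGroup E] [NormedSpace ℝ E] [FiniteDimensional ℝ E]
    {G : Type*} [Group G] [TopologicalSpace G] [ChartedSpace E G] [LieGroup 𝓘(ℝ, E) ∞ G]
    [CompactSpace G] [T2Space G]
    (k : ℕ) (PP P : Fin (k + 1) →o Subgroup G)
    (hPP : ∀ i, IsPToral p (PP i))
    (hP : ∀ i, IsPDiscretization p (P i) (PP i)) :
    ∃ (hle : SubgroupChain.normalizer P ≤ SubgroupChain.normalizer PP)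
      (φ : SubgroupChain.Out P ≃* SubgroupChain.Out PP),
      ∀ n : SubgroupChain.normalizer P,
        φ (QuotientGroup.mk n) = QuotientGroup.mk (Subgroup.inclusion hle n) := by
  have : IsTopologicalGroup G := topologicalGroup_of_lieGroup 𝓘(ℝ, E) ∞
  refine ⟨chain_normalizer_le hP, MulEquiv.ofBijective (QuotientGroup.map _ _
    (Subgroup.inclusion (chain_normalizer_le hP)) fun n hn => chain_inner_le hP hn) ⟨?_, ?_⟩,
    fun n => rfl⟩
  · rw [injective_iff_map_eq_one]
    rintro ⟨n⟩ h
    exact (QuotientGroup.eq_one_iff n).mpr (mem_chain_inner_of_mem hPP hP n.2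
      ((QuotientGroup.eq_one_iff (Subgroup.inclusion (chain_normalizer_le hP) n)).mp h))
  · rintro ⟨g⟩
    obtain ⟨x, hx, hxg⟩ := exists_mul_mem_chain_normalizer hPP hP g.2
    refine ⟨QuotientGroup.mk ⟨x * g, hxg⟩, QuotientGroup.eq_iff_div_mem.mpr ?_⟩
    have hx' : x ∈ SubgroupChain.inner PP := Subgroup.mem_sup_right hx
    simpa [Subgroup.mem_subgroupOf] using hx'
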